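/- Let $k$ be a commutative Artinian ring and $A$ an Artin $k$-algebra, i.e. a unital $k$-algebra that is finitely generated as a $k$-module. Let $A\text{-mod}$ be the category of finitely generated left $A$-modules, and for $M\in A\text{-mod}$ let $\mathrm{add}(M)$ be the class of modules isomorphic to direct summands of finite direct sums of copies of $M$. For $X\in A\text{-mod}$ let $\Omega^0(X)=X$ and let $\Omega^{n+1}(X)$ be the kernel of a projective cover of $\Omega^n(X)$. For $m,n\ge 0$, $A$ is an $(m,n)$-Igusa--Todorov algebra if there is $U\in A\text{-mod}$ such that for every $X\in A\text{-mod}$ there is an exact sequence $0\to U_m\to\cdots\to U_1\to U_0\to\Omega^n(X)\to 0$ with all $U_i\in\mathrm{add}(U)$. The Igusa--Todorov distance of $A$ is $$\mathrm{IT.dist}(A)=\inf\{m : A\text{ is an }(m,n)\text{-Igusa--Todorov algebra for some } n\}.$$ For $M,X\in A\text{-mod}$ let $M\text{-w.resol.dim}(X)$ be the least $n\ge 0$ for which there is an exact sequence $0\to M_n\to\cdots\to M_0\to X\to 0$ with all $M_i\in\mathrm{add}(M)$ (and $\infty$ if there is none). For a full subcategory $\mathscr X$ of $A\text{-mod}$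 put $$\mathrm{w.resol.dim}(\mathscr X)=\min_{M\in A\text{-mod}}\ \sup_{X\in\mathscr X}\ M\text{-w.resol.dim}(X).$$ A module $X$ is Gorenstein-projective if $X\cong\mathrm{Ker}(P^0\to P^1)$ for some exact complex $\cdots\to P^{-1}\to P^0\to P^1\to\cdots$ of finitely generated projective $A$-modules that remains exact under $\mathrm{Hom}_A(-,A)$; let $A\text{-}\mathrm{Gproj}$ be the full subcategory of $A\text{-mod}$ of Gorenstein-projective modules. $A$ is Gorenstein if it has finite injective dimension both as a left and as a right module over itself, and selfinjective if it is injective as a left module over itself. Theorem. If $A$ is Gorenstein, then $$\mathrm{IT.dist}(A)=\mathrm{w.resol.dim}(A\text{-}\mathrm{Gproj}).$$ In particular, if $A$ is selfinjective, then $\mathrm{IT.dist}(A)=\mathrm{w.resol.dim}(A\text{-mod})$. (Both equalities are in $\{0,1,2,\dots\}\cup\{\infty\}$.) -/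

import Mathlib

open CategoryTheory

universe u v

namespace IgusaTodorov

/-- `X ∈ add(M)`: `X` is isomorphic to a direct summand of a finite direct sum of copies
of `M`. -/
def InAdd {A : Type u} [Ring A] (M X : ModuleCat.{u} A) : Prop :=
  ∃ (r : ℕ) (i : X →ₗ[A] (Fin r → M)) (p : (Fin r → M) →ₗ[A] X), p ∘ₗ i = LinearMap.id

/-- There is an exact sequence `0 → Mₙ → ⋯ → M₁ → M₀ → X → 0` with all `Mᵢ ∈ add(M)`.
The sequence is recorded as an infinite one that vanishes from index `n + 1` on. -/
def HasAddResolution {A : Type u} [Ring A] (n : ℕ) (M X : ModuleCat.{u} A) : Prop :=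
  ∃ (C : ℕ → ModuleCat.{u} A) (d : ∀ i : ℕ, C (i + 1) →ₗ[A] C i) (ε : C 0 →ₗ[A] X),
    (∀ i, i ≤ n → InAdd M (C i)) ∧
    (∀ i, n < i → Subsingleton (C i)) ∧
    Function.Surjective ε ∧
    Function.Exact (d 0) ε ∧
    ∀ i, Function.Exact (d (i + 1)) (d i)

/-- `f : P → X` is a projective cover: `P` is projective and `f` is an epimorphism with
superfluous kernel. -/
def IsProjectiveCover {A : Type u} [Ring A] {P X : ModuleCat.{u} A} (f : P →ₗ[A] X) : Prop :=
  Module.Projective A P ∧ Function.Surjective f ∧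
    ∀ N : Submodule A P, N ⊔ LinearMap.ker f = ⊤ → N = ⊤

/-- `IsSyzygy n X K` says that `K` is (isomorphic to) the `n`-th syzygy `Ωⁿ(X)`, formed with
projective covers: `Ω⁰(X) = X`, and `Ωⁿ⁺¹(X)` is the kernel of a projective cover of `Ωⁿ(X)`. -/
def IsSyzygy {A : Type u} [Ring A] : ℕ → ModuleCat.{u} A → ModuleCat.{u} A → Prop
  | 0, X, K => Nonempty (K ≃ₗ[A] X)
  | n + 1, X, K => ∃ Y : ModuleCat.{u} A, IsSyzygy n X Y ∧
      ∃ (P : ModuleCat.{u} A) (f : P →ₗ[A] Y),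
        IsProjectiveCover f ∧ Nonempty (K ≃ₗ[A] LinearMap.ker f)

/-- `A` is an `(m, n)`-Igusa–Todorov algebra: there is a finitely generated module `U` such that
for every finitely generated module `X` there is an exact sequence
`0 → U_m → ⋯ → U₀ → Ωⁿ(X) → 0` with all `Uᵢ ∈ add(U)`. -/
def IsIgusaTodorovAlgebra (A : Type u) [Ring A] (m n : ℕ) : Prop :=
  ∃ U : ModuleCat.{u} A, Module.Finite A U ∧
    ∀ X : ModuleCat.{u} A, Module.Finite A X →
      ∃ K : ModuleCat.{u} A, IsSyzygy n X K ∧ HasAddResolution m U K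

/-- The Igusa–Todorov distance
`inf {m | A is an (m, n)-Igusa–Todorov algebra for some n}`, with `inf ∅ = ∞`. -/
noncomputable def itDist (A : Type u) [Ring A] : ℕ∞ :=
  ⨅ (m : ℕ) (_ : ∃ n : ℕ, IsIgusaTodorovAlgebra A m n), (m : ℕ∞)

/-- The weak `M`-resolution dimension of a module `X` (`∞` if there is no finite
resolution of `X` by modules in `add(M)`). -/
noncomputable def weakResolDimOfModule {A : Type u} [Ring A] (M X : ModuleCat.{u} A) : ℕ∞ :=
  ⨅ (n : ℕ) (_ : HasAddResolution n M X), (n : ℕ∞)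

/-- The weak `M`-resolution dimension of a full subcategory of modules. -/
noncomputable def weakResolDimWith {A : Type u} [Ring A] (M : ModuleCat.{u} A)
    (𝒳 : ObjectProperty (ModuleCat.{u} A)) : ℕ∞ :=
  ⨆ (X : ModuleCat.{u} A) (_ : 𝒳 X), weakResolDimOfModule M X

/-- The weak resolution dimension of a full subcategory of modules: the minimum, over all
finitely generated modules `M`, of its weak `M`-resolution dimension. -/
noncomputable def weakResolDim {A : Type u} [Ring A]
    (𝒳 : ObjectProperty (ModuleCat.{u} A)) : ℕ∞ :=
  ⨅ (M : ModuleCat.{u} A) (_ : Module.Finite A M), weakResolDimWith M 𝒳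

/-- The module `X` is Gorenstein-projective: there is an exact complex
`⋯ → P⁻¹ → P⁰ → P¹ → ⋯` of finitely generated projective modules, which stays exact
under `Hom_A(-, A)`, such that `X ≅ Ker(P⁰ → P¹)`. -/
def IsGorensteinProjective {A : Type u} [Ring A] (X : ModuleCat.{u} A) : Prop :=
  ∃ (P : ℤ → ModuleCat.{u} A) (d : ∀ i : ℤ, P i →ₗ[A] P (i + 1)),
    (∀ i, Module.Finite A (P i) ∧ Module.Projective A (P i)) ∧
    (∀ i, Function.Exact (d i) (d (i + 1))) ∧
    (∀ i, Function.Exact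
      (fun g : P (i + 1 + 1) →ₗ[A] A => g ∘ₗ d (i + 1))
      (fun g : P (i + 1) →ₗ[A] A => g ∘ₗ d i)) ∧
    Nonempty (X ≃ₗ[A] LinearMap.ker (d 0))

/-- The category `A-Gproj` of finitely generated Gorenstein-projective modules. -/
def gproj (A : Type u) [Ring A] : ObjectProperty (ModuleCat.{u} A) :=
  fun X => Module.Finite A X ∧ IsGorensteinProjective X

/-- `A` is Gorenstein: the regular module has finite injective dimension on both sides.
Right `A`-modules are left modules over the opposite ring. -/
def IsGorenstein (A : Type u) [Ring A] : Prop :=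
  (∃ n : ℕ, HasInjectiveDimensionLE (ModuleCat.of A A) n) ∧
    ∃ n : ℕ, HasInjectiveDimensionLE (ModuleCat.of Aᵐᵒᵖ A) n

/-- `A` is selfinjective: the left regular module is injective. -/
def IsSelfinjective (A : Type u) [Ring A] : Prop :=
  Module.Injective A A

end IgusaTodorov

/-! Both equalities follow from one comparison, `itDist_eq_weakResolDim`. Let 𝒳 be a class of
finitely generated modules such that some n-th syzygy functor sends every finitely generated module
into 𝒳, and every X in 𝒳 embeds in a finitely generated projective with cokernel in 𝒳. If add(M)
resolves all of 𝒳 in length m, then M makes A an (m,n)-Igusa–Todorov algebra. Conversely, let U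
witness (m,n') for an arbitrary n'. Taking n' cosyzygies of X in 𝒳 gives Z in 𝒳 with X ≅ Ωⁿ'(Z) ⊕ Q,
Q projective (`exists_equiv_ker_prod`), so a resolution of Ωⁿ'(Z) by add(U) becomes one of X by
add(U ⊕ A) of the same length.

Gorenstein case: 𝒳 is the class of Gorenstein-projectives and n = d bounds the left injective
dimension of A. Then Ωᵈ(X) has no higher extensions by A, and finite right injective dimension makes
such modules Gorenstein-projective. The crux is that they are torsionless
(`torsionless_of_extVanishesFrom`), so that free cosyzygies exist.

Selfinjective case: 𝒳 is the class of all finitely generated modules and n = 0. Only left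
injectivity is assumed, so cosyzygies are obtained directly by showing that every simple module
embeds in A (`IsSelfinjective.exists_ne_zero_of_isSimpleModule`). -/

namespace IgusaTodorov

/-! ### Vanishing of Ext and dimension shifting. -/

section Ext

variable {R : Type u} [Ring R]

/-- All extension groups `Extⁱ(X, N)` with `i ≥ n` vanish. -/
def ExtVanishesFrom (R : Type u) [Ring R] (n : ℕ) (X N : Type u) [AddCommGroup X] [Module R X]
    [AddCommGroup N] [Module R N] : Prop :=
  ∀ i, n ≤ i → ∀ e : Abelian.Ext (ModuleCat.of R X) (ModuleCat.of R N) i, e = 0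

variable {K P Y N : Type u} [AddCommGroup K] [Module R K] [AddCommGroup P] [Module R P]
  [AddCommGroup Y] [Module R Y] [AddCommGroup N] [Module R N]

lemma shortExact_of_linearMap {f : K →ₗ[R] P} {g : P →ₗ[R] Y} (hf : Function.Injective f)
    (hg : Function.Surjective g) (hfg : Function.Exact f g) :
    (ShortComplex.mk (ModuleCat.ofHom f) (ModuleCat.ofHom g)
      (by ext x; exact hfg.apply_apply_eq_zero x)).ShortExact :=
  ModuleCat.shortComplex_shortExact _ hfg hf hg

/-- Dimension shifting for the kernel of an epimorphism from a projective module. -/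
lemma ExtVanishesFrom.of_quotient [Module.Projective R P] {f : K →ₗ[R] P} {g : P →ₗ[R] Y}
    (hf : Function.Injective f) (hg : Function.Surjective g) (hfg : Function.Exact f g)
    {n : ℕ} (hn : 1 ≤ n) (h : ExtVanishesFrom R (n + 1) Y N) : ExtVanishesFrom R n K N := by
  intro i hi e
  have S := shortExact_of_linearMap hf hg hfg
  have : Projective (ModuleCat.of R P) := (IsProjective.iff_projective P).1 inferInstance
  obtain ⟨e', rfl⟩ := Abelian.Ext.contravariant_sequence_exact₁ S _ e (add_comm 1 i)
    (h (i + 1) (by lia) _)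
  obtain ⟨j, rfl⟩ : ∃ j, i = j + 1 := ⟨i - 1, by lia⟩
  have : e' = 0 := Abelian.Ext.eq_zero_of_projective (P := ModuleCat.of R P) e'
  rw [this, Abelian.Ext.comp_zero]

/-- Dimension shifting for a quotient of a projective module. -/
lemma ExtVanishesFrom.of_kernel [Module.Projective R P] {f : K →ₗ[R] P} {g : P →ₗ[R] Y}
    (hf : Function.Injective f) (hg : Function.Surjective g) (hfg : Function.Exact f g)
    {n : ℕ} (h : ExtVanishesFrom R n K N) : ExtVanishesFrom R (n + 1) Y N := by
  intro i hi e
  have S := shortExact_of_linearMap hf hg hfg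
  have : Projective (ModuleCat.of R P) := (IsProjective.iff_projective P).1 inferInstance
  obtain ⟨j, rfl⟩ : ∃ j, i = j + 1 := ⟨i - 1, by lia⟩
  obtain ⟨e', rfl⟩ := Abelian.Ext.contravariant_sequence_exact₃ S _ e
    (Abelian.Ext.eq_zero_of_projective (P := ModuleCat.of R P) _) (add_comm 1 j)
  rw [h j (by lia) e', Abelian.Ext.comp_zero]

/-- The obstruction to extending φ along f is its image under the connecting map to Ext¹(Y, N). -/
lemma ExtVanishesFrom.exists_extension {f : K →ₗ[R] P} {g : P →ₗ[R] Y}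
    (hf : Function.Injective f) (hg : Function.Surjective g) (hfg : Function.Exact f g)
    (h : ExtVanishesFrom R 1 Y N) (φ : K →ₗ[R] N) : ∃ ψ : P →ₗ[R] N, ψ ∘ₗ f = φ := by
  have S := shortExact_of_linearMap hf hg hfg
  obtain ⟨e', he⟩ := Abelian.Ext.contravariant_sequence_exact₁ S (ModuleCat.of R N)
    (Abelian.Ext.mk₀ (ModuleCat.ofHom φ)) (add_zero 1) (h 1 le_rfl _)
  obtain ⟨ψ, rfl⟩ := Abelian.Ext.homEquiv₀.symm.surjective e'
  refine ⟨ψ.hom, ?_⟩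
  have h2 : ModuleCat.ofHom f ≫ ψ = ModuleCat.ofHom φ := by
    apply Abelian.Ext.homEquiv₀.symm.injective
    simpa using he
  simpa using congrArg ModuleCat.Hom.hom h2

/-- As P is projective, Ext¹(Y, N) is the cokernel of Hom(P, N) → Hom(K, N); higher degrees shift to
K. -/
lemma ExtVanishesFrom.of_exists_extension [Module.Projective R P] {f : K →ₗ[R] P}
    {g : P →ₗ[R] Y} (hf : Function.Injective f) (hg : Function.Surjective g)
    (hfg : Function.Exact f g) (h : ExtVanishesFrom R 1 K N)
    (hext : ∀ φ : K →ₗ[R] N, ∃ ψ : P →ₗ[R] N, ψ ∘ₗ f = φ) : ExtVanishesFrom R 1 Y N := by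
  intro i hi e
  obtain rfl | hi := hi.eq_or_lt
  · have S := shortExact_of_linearMap hf hg hfg
    have : Projective (ModuleCat.of R P) := (IsProjective.iff_projective P).1 inferInstance
    obtain ⟨e', rfl⟩ := Abelian.Ext.contravariant_sequence_exact₃ S _ e
      (Abelian.Ext.eq_zero_of_projective (P := ModuleCat.of R P) _) (add_zero 1)
    obtain ⟨φ, rfl⟩ := Abelian.Ext.homEquiv₀.symm.surjective e'
    obtain ⟨ψ, hψ⟩ := hext φ.hom
    have h2 : φ = ModuleCat.ofHom f ≫ ModuleCat.ofHom ψ := by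
      ext1
      simpa using hψ.symm
    rw [h2]
    rw [← Abelian.Ext.mk₀_homEquiv₀_apply (Abelian.Ext.homEquiv₀.symm _), Equiv.apply_symm_apply,
      ← Abelian.Ext.mk₀_comp_mk₀]
    -- The class now factors through the extension class composed with f, which is zero.
    exact S.extClass_comp_assoc (Abelian.Ext.mk₀ (ModuleCat.ofHom ψ))
  · exact h.of_kernel hf hg hfg i hi e

lemma extVanishesFrom_of_hasInjectiveDimensionLE {n : ℕ}
    (h : HasInjectiveDimensionLE (ModuleCat.of R N) n) : ExtVanishesFrom R (n + 1) Y N :=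
  fun _ hi e => Abelian.Ext.eq_zero_of_hasInjectiveDimensionLT e _ hi

end Ext

end IgusaTodorov

namespace IgusaTodorov

/-! ### Duality into A, transposes, and torsionless modules. -/

section Dual

variable {A : Type u} [Ring A] {M N P : Type u} [AddCommGroup M] [Module A M] [AddCommGroup N]
  [Module A N] [AddCommGroup P] [Module A P]

/-- The transpose `Hom(N, A) → Hom(M, A)` of a linear map, as a map of right modules. -/
def transpose (g : M →ₗ[A] N) : (N →ₗ[A] A) →ₗ[Aᵐᵒᵖ] (M →ₗ[A] A) where
  toFun φ := φ ∘ₗ g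
  map_add' _ _ := rfl
  map_smul' _ _ := rfl

@[simp] lemma transpose_apply (g : M →ₗ[A] N) (φ : N →ₗ[A] A) : transpose g φ = φ ∘ₗ g := rfl

/-- Evaluation at an element, as a map of right modules. -/
def evalDual (x : M) : (M →ₗ[A] A) →ₗ[Aᵐᵒᵖ] A where
  toFun φ := φ x
  map_add' _ _ := rfl
  map_smul' _ _ := rfl

@[simp] lemma evalDual_apply (x : M) (φ : M →ₗ[A] A) : evalDual x φ = φ x := rfl

/-- Restriction of linear forms to a finite family of elements. -/
def evalFamily {n : ℕ} (x : Fin n → M) : (M →ₗ[A] A) →ₗ[Aᵐᵒᵖ] (Fin n → A) :=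
  LinearMap.pi fun i => evalDual (x i)

lemma evalFamily_injective {n : ℕ} {x : Fin n → M}
    (hx : Submodule.span A (Set.range x) = ⊤) :
    Function.Injective (evalFamily (A := A) x) := by
  intro φ ψ h
  refine LinearMap.ext_on_range hx fun i => ?_
  exact congrFun h i

/-- The regular right module, as a module over itself and over the opposite ring. -/
def opSelfEquiv (A : Type u) [Ring A] : Aᵐᵒᵖ ≃ₗ[Aᵐᵒᵖ] A :=
  { (MulOpposite.opAddEquiv (α := A)).symm with map_smul' := fun _ _ => rfl }

lemma sum_proj_smul {n : ℕ} (φ : (Fin n → A) →ₗ[A] A) :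
    φ = ∑ i, MulOpposite.op (φ (Pi.single i 1)) • (LinearMap.proj i : (Fin n → A) →ₗ[A] A) := by
  refine LinearMap.pi_ext' fun i => LinearMap.ext_ring ?_
  simp [Pi.single_apply]

/-- The dual of a finite free left module is finite free on the right. -/
def dualFreeEquiv (A : Type u) [Ring A] (n : ℕ) :
    ((Fin n → A) →ₗ[A] A) ≃ₗ[Aᵐᵒᵖ] (Fin n → A) where
  __ := evalFamily fun i => (Pi.single i 1 : Fin n → A)
  invFun a := ∑ i, MulOpposite.op (a i) • (LinearMap.proj i : (Fin n → A) →ₗ[A] A)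
  left_inv φ := (sum_proj_smul φ).symm
  right_inv a := by
    ext i
    simp [evalFamily, Pi.single_apply]

instance projective_dual_free (n : ℕ) : Module.Projective Aᵐᵒᵖ ((Fin n → A) →ₗ[A] A) :=
  Module.Projective.of_equiv
    (LinearEquiv.piCongrRight (fun _ : Fin n => opSelfEquiv A) ≪≫ₗ (dualFreeEquiv A n).symm)

/-- Finite free modules are reflexive. -/
lemma exists_eq_eval {n : ℕ} (ψ : ((Fin n → A) →ₗ[A] A) →ₗ[Aᵐᵒᵖ] A) :
    ∃ q : Fin n → A, ∀ φ, ψ φ = φ q := by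
  refine ⟨fun i => ψ (LinearMap.proj i), fun φ => ?_⟩
  rw [sum_proj_smul φ, map_sum]
  simp [LinearMap.sum_apply]

variable (M) in
lemma exists_free_surjection [Module.Finite A M] :
    ∃ (n : ℕ) (ε : (Fin n → A) →ₗ[A] M), Function.Surjective ε := by
  obtain ⟨n, f, hf⟩ := Module.Finite.exists_fin' A M
  exact ⟨n, f, hf⟩

/-- The transpose of the module presented by `g`. -/
abbrev Transpose (g : M →ₗ[A] N) : Type u := (M →ₗ[A] A) ⧸ LinearMap.range (transpose g)

/-- An exact sequence `P → M → N` whose dual is exact gives an embedding of the transpose. -/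
def transposeEmbedding (h : P →ₗ[A] M) (g : M →ₗ[A] N) (hgh : g ∘ₗ h = 0) :
    Transpose g →ₗ[Aᵐᵒᵖ] (P →ₗ[A] A) :=
  (LinearMap.range (transpose g)).liftQ (transpose h) (by
    rintro _ ⟨φ, rfl⟩
    rw [LinearMap.mem_ker, transpose_apply, transpose_apply, LinearMap.comp_assoc, hgh,
      LinearMap.comp_zero])

/-- Dual exactness of a segment of a projective resolution of a module `X` with
`Ext¹(X, A) = 0`. -/
lemma exists_factor_of_extVanishesFrom {X : Type u} [AddCommGroup X] [Module A X]
    {h : P →ₗ[A] M} {g : M →ₗ[A] N} {ε : N →ₗ[A] X} (hε : Function.Surjective ε)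
    (hg : Function.Exact g ε) (hh : Function.Exact h g) (hX : ExtVanishesFrom A 1 X A)
    (φ : M →ₗ[A] A) (hφ : φ ∘ₗ h = 0) : ∃ ψ : N →ₗ[A] A, ψ ∘ₗ g = φ := by
  have hle : LinearMap.ker g ≤ LinearMap.ker φ := by
    rw [hh.linearMap_ker_eq]
    rintro _ ⟨y, rfl⟩
    exact LinearMap.congr_fun hφ y
  let φ' : LinearMap.range g →ₗ[A] A :=
    (LinearMap.ker g).liftQ φ hle ∘ₗ g.quotKerEquivRange.symm.toLinearMap
  have hφ' : ∀ y, φ' (g.rangeRestrict y) = φ y := by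
    intro y
    have : g.rangeRestrict y = g.quotKerEquivRange (Submodule.Quotient.mk y) := by
      ext; simp
    simp [φ', this]
  obtain ⟨ψ, hψ⟩ := hX.exists_extension (f := (LinearMap.range g).subtype) (g := ε)
    (Submodule.subtype_injective _) hε (by
      rw [LinearMap.exact_iff, hg.linearMap_ker_eq, Submodule.range_subtype]) φ'
  refine ⟨ψ, LinearMap.ext fun y => ?_⟩
  rw [← hφ' y, ← hψ]
  rfl

/-- If `Ext` into `A` vanishes from degree `n + 1` on for right modules, then it vanishes in all
positive degrees for the transpose of a module `X` with `Extⁱ(X, A) = 0` for `i > 0`. -/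
lemma extVanishesFrom_transpose [IsNoetherianRing A] {d : ℕ}
    (hd : HasInjectiveDimensionLE (ModuleCat.of Aᵐᵒᵖ A) d) (n : ℕ) (hn : 1 ≤ n) :
    ∀ (X : Type u) [AddCommGroup X] [Module A X], ExtVanishesFrom A 1 X A →
    ∀ (p q : ℕ) (g : (Fin q → A) →ₗ[A] (Fin p → A)) (ε : (Fin p → A) →ₗ[A] X),
      Function.Surjective ε → Function.Exact g ε →
      ExtVanishesFrom Aᵐᵒᵖ n (Transpose g) A := by
  by_cases hnd : d + 1 ≤ n
  · intro X _ _ _ p q g ε _ _ i hi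
    exact extVanishesFrom_of_hasInjectiveDimensionLE hd i (by lia)
  -- Descending induction on n: above d the injective dimension suffices, and below it vanishing
  -- from n + 1 for the syzygy of X gives vanishing from n for X.
  induction hk : d + 1 - n generalizing n with
  | zero => lia
  | succ k ih =>
    have step : ∀ (X : Type u) [AddCommGroup X] [Module A X], ExtVanishesFrom A 1 X A →
        ∀ (p q : ℕ) (g : (Fin q → A) →ₗ[A] (Fin p → A)) (ε : (Fin p → A) →ₗ[A] X),
        Function.Surjective ε → Function.Exact g ε →
        ExtVanishesFrom Aᵐᵒᵖ (n + 1) (Transpose g) A := by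
      by_cases h' : d + 1 ≤ n + 1
      · intro X _ _ _ p q g ε _ _ i hi
        exact extVanishesFrom_of_hasInjectiveDimensionLE hd i (by lia)
      · exact ih (n + 1) (by lia) h' (by lia)
    intro X _ _ hX p q g ε hε hg
    obtain ⟨r, h', hh'⟩ := exists_free_surjection (A := A) (LinearMap.ker g)
    set h : (Fin r → A) →ₗ[A] (Fin q → A) := (LinearMap.ker g).subtype ∘ₗ h' with hdef
    have hh : Function.Exact h g := by
      rw [LinearMap.exact_iff, hdef, LinearMap.range_comp, LinearMap.range_eq_top.2 hh',
        Submodule.map_top, Submodule.range_subtype]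
    -- the first syzygy of `X`
    have hS : ExtVanishesFrom A 1 (LinearMap.ker ε) A :=
      ExtVanishesFrom.of_quotient (Submodule.subtype_injective _) hε
        (by rw [LinearMap.exact_iff, Submodule.range_subtype]) le_rfl
        (fun i hi => hX i (by lia))
    let g' : (Fin q → A) →ₗ[A] LinearMap.ker ε :=
      g.codRestrict _ fun y => hg.apply_apply_eq_zero y
    have hg' : Function.Surjective g' := by
      rintro ⟨y, hy⟩
      obtain ⟨z, hz⟩ := (hg y).1 hy
      exact ⟨z, Subtype.ext hz⟩
    have hhg' : Function.Exact h g' := by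
      rw [LinearMap.exact_iff, show LinearMap.ker g' = LinearMap.ker g from
        LinearMap.ker_codRestrict _ _ _, ← LinearMap.exact_iff]
      exact hh
    -- The sequence 0 → Tr X → (Aʳ)* → Tr(ΩX) → 0 has projective middle term; it is injective on the
    -- left because Ext¹(X, A) = 0.
    refine ExtVanishesFrom.of_quotient
      (f := transposeEmbedding h g (hh.linearMap_comp_eq_zero))
      (g := (LinearMap.range (transpose h)).mkQ) ?_ (Submodule.mkQ_surjective _) ?_ hn
      (step _ hS q r h g' hg' hhg')
    · rw [← LinearMap.ker_eq_bot, transposeEmbedding, Submodule.ker_liftQ_eq_bot]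
      intro φ hφ
      obtain ⟨ψ, hψ⟩ := exists_factor_of_extVanishesFrom hε hg hh hX φ hφ
      exact ⟨ψ, hψ⟩
    · rw [LinearMap.exact_iff, Submodule.ker_mkQ, transposeEmbedding, Submodule.range_liftQ]

/-- A finitely generated module without extensions by `A` is torsionless. -/
lemma torsionless_of_extVanishesFrom [IsNoetherianRing A] {d : ℕ}
    (hd : HasInjectiveDimensionLE (ModuleCat.of Aᵐᵒᵖ A) d) [Module.Finite A M]
    (hM : ExtVanishesFrom A 1 M A) (x : M) (hx : ∀ φ : M →ₗ[A] A, φ x = 0) : x = 0 := by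
  obtain ⟨p, ε, hε⟩ := exists_free_surjection (A := A) M
  obtain ⟨q, g', hg'⟩ := exists_free_surjection (A := A) (LinearMap.ker ε)
  set g : (Fin q → A) →ₗ[A] (Fin p → A) := (LinearMap.ker ε).subtype ∘ₗ g' with hdef
  have hg : Function.Exact g ε := by
    rw [LinearMap.exact_iff, hdef, LinearMap.range_comp, LinearMap.range_eq_top.2 hg',
      Submodule.map_top, Submodule.range_subtype]
  have hT := extVanishesFrom_transpose hd 1 le_rfl M hM p q g ε hε hg
  obtain ⟨y, rfl⟩ := hε x
  -- A form killed by `transpose g` descends to M, hence vanishes at y. So φ ∘ g ↦ φ y is well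
  -- defined on the range; it extends to (A^q)* since Ext¹ of the transpose vanishes, and
  -- reflexivity realises the extension as evaluation at some z with g z = y.
  have hle : LinearMap.ker (transpose g) ≤ LinearMap.ker (evalDual (A := A) y) := by
    intro φ hφ
    have hle' : LinearMap.ker ε ≤ LinearMap.ker φ := by
      rw [hg.linearMap_ker_eq]
      rintro _ ⟨z, rfl⟩
      exact LinearMap.congr_fun hφ z
    have := hx ((LinearMap.ker ε).liftQ φ hle' ∘ₗ (ε.quotKerEquivOfSurjective hε).symm.toLinearMap)
    have h2 : ε y = ε.quotKerEquivOfSurjective hε (Submodule.Quotient.mk y) := by simp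
    rw [h2] at this
    simpa using this
  let ev : LinearMap.range (transpose g) →ₗ[Aᵐᵒᵖ] A :=
    (LinearMap.ker (transpose g)).liftQ _ hle ∘ₗ (transpose g).quotKerEquivRange.symm.toLinearMap
  have hev : ∀ φ, ev ((transpose g).rangeRestrict φ) = φ y := by
    intro φ
    have : (transpose g).rangeRestrict φ =
        (transpose g).quotKerEquivRange (Submodule.Quotient.mk φ) := by
      ext; simp
    simp [ev, this]
  obtain ⟨ψ, hψ⟩ := hT.exists_extension (Submodule.subtype_injective _)
    (Submodule.mkQ_surjective _) (LinearMap.exact_subtype_mkQ (LinearMap.range (transpose g))) ev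
  obtain ⟨z, hz⟩ := exists_eq_eval ψ
  have hzy : g z = y := by
    ext i
    have h1 := hz (transpose g (LinearMap.proj i))
    have h2 := hev (LinearMap.proj i)
    rw [← hψ] at h2
    exact h1.symm.trans h2
  rw [← hzy]
  exact hg.apply_apply_eq_zero z

/-- A left approximation of a torsionless module by a free module: an embedding through which
all linear forms factor. -/
lemma exists_approximation [IsNoetherian Aᵐᵒᵖ A] [Module.Finite A M]
    (hM : ∀ x : M, (∀ φ : M →ₗ[A] A, φ x = 0) → x = 0) :
    ∃ (n : ℕ) (ι : M →ₗ[A] (Fin n → A)), Function.Injective ι ∧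
      ∀ φ : M →ₗ[A] A, ∃ ψ : (Fin n → A) →ₗ[A] A, ψ ∘ₗ ι = φ := by
  obtain ⟨n, x, hx⟩ := Module.Finite.exists_fin (R := A) (M := M)
  have : IsNoetherian Aᵐᵒᵖ (M →ₗ[A] A) :=
    isNoetherian_of_injective (evalFamily x) (evalFamily_injective hx)
  obtain ⟨r, f, hf⟩ := Module.Finite.exists_fin (R := Aᵐᵒᵖ) (M := M →ₗ[A] A)
  -- The coordinates of the embedding are generators of the dual as a right module.
  refine ⟨r, LinearMap.pi f, ?_, ?_⟩
  · rw [injective_iff_map_eq_zero]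
    intro y hy
    refine hM y fun φ => ?_
    have hφ : φ ∈ Submodule.span Aᵐᵒᵖ (Set.range f) := hf ▸ Submodule.mem_top
    obtain ⟨c, rfl⟩ := (Submodule.mem_span_range_iff_exists_fun _).1 hφ
    rw [LinearMap.sum_apply]
    refine Finset.sum_eq_zero fun i _ => ?_
    have : f i y = 0 := congrFun hy i
    simp [this]
  · intro φ
    have hφ : φ ∈ Submodule.span Aᵐᵒᵖ (Set.range f) := hf ▸ Submodule.mem_top
    obtain ⟨c, rfl⟩ := (Submodule.mem_span_range_iff_exists_fun _).1 hφ
    refine ⟨∑ i, c i • LinearMap.proj i, ?_⟩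
    ext y
    simp [LinearMap.sum_apply]

end Dual

end IgusaTodorov

/-! ### Complete resolutions of modules without extensions by A. -/

namespace IgusaTodorov

/-- A relation that is total in both directions has bi-infinite chains through every element. -/
lemma exists_int_chain {α : Type*} {r : α → α → Prop} (hr : ∀ x, ∃ y, r x y)
    (hl : ∀ x, ∃ y, r y x) (x : α) : ∃ Z : ℤ → α, Z 0 = x ∧ ∀ i, r (Z i) (Z (i + 1)) := by
  choose s hs using hr
  choose p hp using hl
  let Z : ℤ → α := fun i => match i with
    | Int.ofNat n => s^[n] x
    | Int.negSucc n => p^[n + 1] x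
  refine ⟨Z, rfl, fun i => ?_⟩
  match i with
  | Int.ofNat n =>
    change r (s^[n] x) (s^[n + 1] x)
    rw [Function.iterate_succ_apply']
    exact hs _
  | Int.negSucc 0 => exact hp x
  | Int.negSucc (n + 1) =>
    rw [show Int.negSucc (n + 1) + 1 = Int.negSucc n by lia]
    change r (p^[n + 1 + 1] x) (p^[n + 1] x)
    rw [Function.iterate_succ_apply' p (n + 1)]
    exact hp _

section

variable {A : Type u} [Ring A]

/-- Finitely generated modules `X` with `Extⁱ(X, A) = 0` for all `i > 0`. -/
def IsExtPerp (X : ModuleCat.{u} A) : Prop :=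
  Module.Finite A X ∧ ExtVanishesFrom A 1 X A

/-- Torsionlessness gives the embedding; since every form on X factors through it, the cokernel
again has vanishing Ext¹ into A. -/
lemma IsExtPerp.exists_cosyzygy [IsNoetherianRing A] [IsNoetherian Aᵐᵒᵖ A] {d : ℕ}
    (hd : HasInjectiveDimensionLE (ModuleCat.of Aᵐᵒᵖ A) d) {X : ModuleCat.{u} A}
    (hX : IsExtPerp X) : ∃ (Y : ModuleCat.{u} A) (_ : IsExtPerp Y) (n : ℕ)
      (ι : X →ₗ[A] (Fin n → A)) (π : (Fin n → A) →ₗ[A] Y),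
      Function.Injective ι ∧ Function.Surjective π ∧ Function.Exact ι π := by
  obtain ⟨hfin, hext⟩ := hX
  obtain ⟨n, ι, hι, hfac⟩ := exists_approximation (A := A) (M := X)
    (torsionless_of_extVanishesFrom hd hext)
  refine ⟨ModuleCat.of A ((Fin n → A) ⧸ LinearMap.range ι), ⟨inferInstance, ?_⟩, n, ι,
    (LinearMap.range ι).mkQ, hι, Submodule.mkQ_surjective _, LinearMap.exact_map_mkQ_range ι⟩
  exact ExtVanishesFrom.of_exists_extension hι (Submodule.mkQ_surjective _)
    (LinearMap.exact_map_mkQ_range ι) hext hfac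

lemma IsExtPerp.exists_syzygy [IsNoetherianRing A] {X : ModuleCat.{u} A}
    (hX : IsExtPerp X) : ∃ (Y : ModuleCat.{u} A) (_ : IsExtPerp Y) (n : ℕ)
      (ι : Y →ₗ[A] (Fin n → A)) (π : (Fin n → A) →ₗ[A] X),
      Function.Injective ι ∧ Function.Surjective π ∧ Function.Exact ι π := by
  obtain ⟨hfin, hext⟩ := hX
  obtain ⟨n, π, hπ⟩ := exists_free_surjection (A := A) X
  refine ⟨ModuleCat.of A (LinearMap.ker π), ⟨inferInstance, ?_⟩, n,
    (LinearMap.ker π).subtype, π, Submodule.subtype_injective _, hπ,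
    LinearMap.exact_subtype_ker_map π⟩
  exact ExtVanishesFrom.of_quotient (Submodule.subtype_injective _) hπ
    (LinearMap.exact_subtype_ker_map π) le_rfl fun i hi => hext i (by lia)

/-- Over an algebra of finite right selfinjective dimension, finitely generated modules without
extensions by `A` are Gorenstein-projective. -/
lemma IsExtPerp.isGorensteinProjective [IsNoetherianRing A] [IsNoetherian Aᵐᵒᵖ A] {d : ℕ}
    (hd : HasInjectiveDimensionLE (ModuleCat.of Aᵐᵒᵖ A) d) {X : ModuleCat.{u} A}
    (hX : IsExtPerp X) : IsGorensteinProjective X := by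
  let r : {X : ModuleCat.{u} A // IsExtPerp X} → {X : ModuleCat.{u} A // IsExtPerp X} → Prop :=
    fun X Y => ∃ (n : ℕ) (ι : X.1 →ₗ[A] (Fin n → A)) (π : (Fin n → A) →ₗ[A] Y.1),
      Function.Injective ι ∧ Function.Surjective π ∧ Function.Exact ι π
  obtain ⟨Z, hZ0, hZ⟩ := exists_int_chain (r := r)
    (fun X => by
      obtain ⟨Y, hY, h⟩ := X.2.exists_cosyzygy hd
      exact ⟨⟨Y, hY⟩, h⟩)
    (fun X => by
      obtain ⟨Y, hY, h⟩ := X.2.exists_syzygy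
      exact ⟨⟨Y, hY⟩, h⟩) ⟨X, hX⟩
  obtain rfl : (Z 0).1 = X := by rw [hZ0]
  choose n ι π hι hπ hex using hZ
  have hker : ∀ i, LinearMap.ker (ι (i + 1) ∘ₗ π i) = LinearMap.range (ι i) := fun i => by
    rw [LinearMap.ker_comp_of_ker_eq_bot _ (LinearMap.ker_eq_bot.2 (hι _)),
      (hex i).linearMap_ker_eq]
  refine ⟨fun i => ModuleCat.of A (Fin (n i) → A), fun i => ι (i + 1) ∘ₗ π i,
    fun i => ⟨inferInstanceAs (Module.Finite A (Fin (n i) → A)),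
      inferInstanceAs (Module.Projective A (Fin (n i) → A))⟩, fun i => ?_, fun i => ?_, ?_⟩
  · rw [LinearMap.exact_iff, hker, LinearMap.range_comp, LinearMap.range_eq_top.2 (hπ i),
      Submodule.map_top]
  · intro φ
    constructor
    · intro hφ
      have h1 : φ ∘ₗ ι (i + 1) = 0 := by
        ext z
        obtain ⟨y, rfl⟩ := hπ i z
        exact LinearMap.congr_fun hφ y
      have hle : LinearMap.ker (π (i + 1)) ≤ LinearMap.ker φ := by
        rw [(hex (i + 1)).linearMap_ker_eq]
        rintro _ ⟨z, rfl⟩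
        exact LinearMap.congr_fun h1 z
      -- φ descends to `Z (i + 2)`, and the obstruction to extending it along `ι (i + 2)` lies in
      -- Ext¹(`Z (i + 3)`, A) = 0.
      obtain ⟨ψ, hψ⟩ := (Z (i + 1 + 1 + 1)).2.2.exists_extension (hι _) (hπ _)
        (hex (i + 1 + 1)) ((LinearMap.ker (π (i + 1))).liftQ φ hle ∘ₗ
          ((π (i + 1)).quotKerEquivOfSurjective (hπ _)).symm.toLinearMap)
      refine ⟨ψ, ?_⟩
      refine LinearMap.ext fun y => ?_
      have h2 := LinearMap.congr_fun hψ (π (i + 1) y)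
      have h3 : π (i + 1) y =
        (π (i + 1)).quotKerEquivOfSurjective (hπ _) (Submodule.Quotient.mk y) := by simp
      refine h2.trans ?_
      rw [h3]
      simp
    · rintro ⟨ψ, rfl⟩
      refine LinearMap.ext fun y => ?_
      have := (hex (i + 1)).apply_apply_eq_zero (π i y)
      change ψ (ι (i + 1 + 1) (π (i + 1) (ι (i + 1) (π i y)))) = 0
      rw [this, map_zero, map_zero]
  · exact ⟨LinearEquiv.ofInjective (ι 0) (hι 0) ≪≫ₗ LinearEquiv.ofEq _ _ (hker 0).symm⟩

/-! ### Projective covers and syzygies over Artinian rings. -/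

/-- Finitely generated modules over Artinian rings have projective covers. -/
lemma exists_isProjectiveCover [IsArtinianRing A] (X : ModuleCat.{u} A) [Module.Finite A X] :
    ∃ (P : ModuleCat.{u} A) (f : P →ₗ[A] X), Module.Finite A P ∧ IsProjectiveCover f := by
  obtain ⟨n, g, hg⟩ := exists_free_surjection (A := A) X
  -- Minimality among the submodules that supplement the kernel makes the kernel of g restricted to
  -- N superfluous.
  obtain ⟨N, hN, hmin⟩ := IsArtinian.set_has_minimal
    {N : Submodule A (Fin n → A) | N ⊔ LinearMap.ker g = ⊤} ⟨⊤, top_sup_eq _⟩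
  have hN : N ⊔ LinearMap.ker g = ⊤ := hN
  set f : N →ₗ[A] X := g ∘ₗ N.subtype with hf
  have hsurj : ∀ {L : Submodule A (Fin n → A)}, L ⊔ LinearMap.ker g = ⊤ ↔
      Submodule.map g L = ⊤ := (LinearMap.map_eq_top_iff (LinearMap.range_eq_top.2 hg)).symm
  have hfsurj : Function.Surjective f := by
    rw [← LinearMap.range_eq_top, LinearMap.range_comp, Submodule.range_subtype]
    exact hsurj.1 hN
  have hsup : ∀ L : Submodule A N, L ⊔ LinearMap.ker f = ⊤ → L = ⊤ := by
    intro L hL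
    have h1 : Submodule.map f L = ⊤ :=
      (LinearMap.map_eq_top_iff (LinearMap.range_eq_top.2 hfsurj)).2 hL
    have h2 : L.map N.subtype ⊔ LinearMap.ker g = ⊤ := by
      rw [hsurj, ← Submodule.map_comp]
      exact h1
    have h3 := hmin _ h2
    have h4 : L.map N.subtype = N :=
      (Submodule.map_subtype_le N L).eq_of_not_lt h3
    rw [← Submodule.comap_subtype_self, ← Submodule.comap_map_eq_of_injective
      (Submodule.subtype_injective N) L, h4]
  refine ⟨ModuleCat.of A N, f, inferInstanceAs (Module.Finite A N), ?_, hfsurj, hsup⟩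
  -- `N` is a direct summand of the free module
  obtain ⟨h, hh⟩ := Module.projective_lifting_property f g hfsurj
  have hcomp : f ∘ₗ (h ∘ₗ N.subtype) = f := by
    rw [← LinearMap.comp_assoc, hh]
  have hsurj' : Function.Surjective (h ∘ₗ N.subtype) := by
    rw [← LinearMap.range_eq_top]
    refine hsup _ ?_
    rw [eq_top_iff]
    intro x _
    rw [show x = (h ∘ₗ N.subtype) x + (x - (h ∘ₗ N.subtype) x) by abel]
    refine Submodule.add_mem_sup ⟨x, rfl⟩ ?_
    rw [LinearMap.mem_ker, map_sub, sub_eq_zero]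
    exact (LinearMap.congr_fun hcomp x).symm
  have hbij := IsNoetherian.bijective_of_surjective_endomorphism _ hsurj'
  let e := LinearEquiv.ofBijective _ hbij
  refine Module.Projective.of_split (N.subtype ∘ₗ e.symm.toLinearMap) h ?_
  refine LinearMap.ext fun x => ?_
  exact e.apply_symm_apply x

/-- Syzygies of finitely generated modules exist over Artinian rings, are finitely generated,
and lower the degrees of nonvanishing extensions by `A`. -/
lemma exists_isSyzygy [IsArtinianRing A] {X : ModuleCat.{u} A} [Module.Finite A X] (n : ℕ) :
    ∃ K : ModuleCat.{u} A, IsSyzygy n X K ∧ Module.Finite A K ∧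
      ∀ j, ExtVanishesFrom A (j + n + 1) X A → ExtVanishesFrom A (j + 1) K A := by
  induction n with
  | zero => exact ⟨X, ⟨LinearEquiv.refl A X⟩, inferInstance, fun j h => h⟩
  | succ n ih =>
    obtain ⟨Y, hY, hfin, hext⟩ := ih
    obtain ⟨P, f, hP, hf⟩ := exists_isProjectiveCover Y
    have := hf.1
    refine ⟨ModuleCat.of A (LinearMap.ker f), ⟨Y, hY, P, f, hf, ⟨LinearEquiv.refl _ _⟩⟩,
      inferInstanceAs (Module.Finite A (LinearMap.ker f)), fun j hj => ?_⟩
    exact ExtVanishesFrom.of_quotient (Submodule.subtype_injective _) hf.2.1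
      (LinearMap.exact_subtype_ker_map f) (by lia)
      (hext (j + 1) (by rwa [show j + 1 + n + 1 = j + (n + 1) + 1 by lia]))

/-- Over a Gorenstein Artin algebra, high syzygies are Gorenstein-projective. -/
lemma exists_isSyzygy_gproj [IsArtinianRing A] [IsNoetherian Aᵐᵒᵖ A] {d d' : ℕ}
    (hd : HasInjectiveDimensionLE (ModuleCat.of A A) d)
    (hd' : HasInjectiveDimensionLE (ModuleCat.of Aᵐᵒᵖ A) d')
    (X : ModuleCat.{u} A) [Module.Finite A X] :
    ∃ K : ModuleCat.{u} A, IsSyzygy d X K ∧ gproj A K := by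
  obtain ⟨K, hK, hfin, hext⟩ := exists_isSyzygy (X := X) d
  refine ⟨K, hK, hfin, IsExtPerp.isGorensteinProjective hd' ⟨hfin, ?_⟩⟩
  exact hext 0 (by rw [zero_add]; exact extVanishesFrom_of_hasInjectiveDimensionLE hd)

end

end IgusaTodorov

/-! ### Resolutions by add(M) and projective summands. -/

namespace IgusaTodorov

section

variable {A : Type u} [Ring A]

lemma InAdd.of_subsingleton (M X : ModuleCat.{u} A) [Subsingleton X] : InAdd M X :=
  ⟨0, 0, 0, LinearMap.ext fun _ => Subsingleton.elim _ _⟩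

lemma InAdd.prod {M X Y : ModuleCat.{u} A} (hX : InAdd M X) (hY : InAdd M Y) :
    InAdd M (ModuleCat.of A (X × Y)) := by
  obtain ⟨r, i, p, hp⟩ := hX
  obtain ⟨s, j, q, hq⟩ := hY
  let e : ((Fin r → M) × (Fin s → M)) ≃ₗ[A] (Fin (r + s) → M) :=
    (LinearEquiv.sumArrowLequivProdArrow (Fin r) (Fin s) A M).symm ≪≫ₗ
      LinearEquiv.funCongrLeft A M finSumFinEquiv.symm
  refine ⟨r + s, e.toLinearMap ∘ₗ i.prodMap j, p.prodMap q ∘ₗ e.symm.toLinearMap, ?_⟩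
  refine LinearMap.ext fun x => ?_
  change p.prodMap q (e.symm (e (i.prodMap j x))) = x
  rw [e.symm_apply_apply]
  exact Prod.ext (LinearMap.congr_fun hp x.1) (LinearMap.congr_fun hq x.2)

lemma InAdd.of_retract {M N X : ModuleCat.{u} A} (hX : InAdd M X) (f : M →ₗ[A] N)
    (g : N →ₗ[A] M) (hgf : g ∘ₗ f = LinearMap.id) : InAdd N X := by
  obtain ⟨r, i, p, hp⟩ := hX
  refine ⟨r, f.compLeft (Fin r) ∘ₗ i, p ∘ₗ g.compLeft (Fin r), ?_⟩
  refine LinearMap.ext fun x => ?_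
  have : g.compLeft (Fin r) (f.compLeft (Fin r) (i x)) = i x := by
    ext j
    exact LinearMap.congr_fun hgf (i x j)
  change p (g.compLeft (Fin r) (f.compLeft (Fin r) (i x))) = x
  rw [this]
  exact LinearMap.congr_fun hp x

lemma inAdd_self_of_projective (Q : ModuleCat.{u} A) [Module.Finite A Q] [Module.Projective A Q] :
    InAdd (ModuleCat.of A A) Q := by
  obtain ⟨n, p, i, -, -, h⟩ := Module.Finite.exists_comp_eq_id_of_projective A Q
  exact ⟨n, i, p, h⟩

lemma HasAddResolution.mono {m n : ℕ} (hmn : m ≤ n) {M X : ModuleCat.{u} A}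
    (h : HasAddResolution m M X) : HasAddResolution n M X := by
  obtain ⟨C, d, ε, hC, h0, hε, hd, hex⟩ := h
  refine ⟨C, d, ε, fun i _ => ?_, fun i hi => h0 i (by lia), hε, hd, hex⟩
  by_cases hi : i ≤ m
  · exact hC i hi
  · have := h0 i (by lia)
    exact InAdd.of_subsingleton M (C i)

lemma HasAddResolution.of_equiv_prod {m : ℕ} {U K Q X : ModuleCat.{u} A}
    (h : HasAddResolution m U K) [Module.Finite A Q] [Module.Projective A Q]
    (e : X ≃ₗ[A] K × Q) : HasAddResolution m (ModuleCat.of A (U × A)) X := by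
  obtain ⟨C, d, ε, hC, h0, hε, hd, hex⟩ := h
  have hU : ∀ {Y : ModuleCat.{u} A}, InAdd U Y → InAdd (ModuleCat.of A (U × A)) Y := fun h =>
    h.of_retract (LinearMap.inl A U A) (LinearMap.fst A U A) (LinearMap.fst_comp_inl A U A)
  have hA : ∀ {Y : ModuleCat.{u} A}, InAdd (ModuleCat.of A A) Y →
      InAdd (ModuleCat.of A (U × A)) Y := fun h =>
    h.of_retract (LinearMap.inr A U A) (LinearMap.snd A U A) (LinearMap.snd_comp_inr A U A)
  -- The projective summand Q is added in degree 0 only, so the length does not change.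
  let C' : ℕ → ModuleCat.{u} A := fun
    | 0 => ModuleCat.of A (C 0 × Q)
    | i + 1 => C (i + 1)
  let d' : ∀ i, C' (i + 1) →ₗ[A] C' i := fun
    | 0 => LinearMap.inl A (C 0) Q ∘ₗ d 0
    | i + 1 => d (i + 1)
  refine ⟨C', d', e.symm.toLinearMap ∘ₗ ε.prodMap LinearMap.id, ?_, ?_, ?_, ?_, ?_⟩
  · rintro (_ | i) hi
    · exact (hU (hC 0 hi)).prod (hA (inAdd_self_of_projective Q))
    · exact hU (hC _ hi)
  · rintro (_ | i) hi
    · lia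
    · exact h0 _ hi
  · exact e.symm.surjective.comp (Function.Surjective.prodMap hε Function.surjective_id)
  · rintro ⟨c, q⟩
    change e.symm (ε c, q) = 0 ↔ ∃ y, (d 0 y, (0 : Q)) = (c, q)
    rw [LinearEquiv.map_eq_zero_iff, Prod.mk_eq_zero, hd c]
    simp [eq_comm]
  · rintro (_ | i)
    · intro y
      refine Iff.trans ?_ (hex 0 y)
      change (d 0 y, (0 : Q)) = 0 ↔ _
      simp
    · exact hex (i + 1)

/-- A kernel of an epimorphism from a projective module is the kernel of the projective cover, up
to a projective summand. -/
lemma exists_equiv_ker_prod [IsNoetherianRing A] {X P Y Y' Q P' : ModuleCat.{u} A}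
    [Module.Finite A P] [Module.Projective A P] [Module.Projective A Q] {ι : X →ₗ[A] P}
    {π : P →ₗ[A] Y} (hι : Function.Injective ι) (hπ : Function.Surjective π)
    (hex : Function.Exact ι π) (e : Y ≃ₗ[A] Y' × Q) {f : P' →ₗ[A] Y'}
    (hf : IsProjectiveCover f) :
    ∃ Q' : ModuleCat.{u} A, Module.Finite A Q' ∧ Module.Projective A Q' ∧
      Nonempty (X ≃ₗ[A] LinearMap.ker f × Q') := by
  obtain ⟨hP', hfs, hsup⟩ := hf
  obtain ⟨h, hh⟩ := Module.projective_lifting_property (f.prodMap (LinearMap.id (M := Q)))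
    (e.toLinearMap ∘ₗ π) (Function.Surjective.prodMap hfs Function.surjective_id)
  have hh' : ∀ y, (f (h y).1, (h y).2) = e (π y) := fun y => LinearMap.congr_fun hh y
  have hlift : ∀ (y' : Y') (q : Q), ∃ l, f (h l).1 = y' ∧ (h l).2 = q := fun y' q => by
    obtain ⟨l, hl⟩ := hπ (e.symm (y', q))
    have := hh' l
    rw [hl, e.apply_symm_apply, Prod.mk_inj] at this
    exact ⟨l, this⟩
  -- The part of the range of h inside P' supplements ker f, which is superfluous.
  have htop : (LinearMap.range h).comap (LinearMap.inl A P' Q) = ⊤ := by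
    refine hsup _ (eq_top_iff.2 fun p _ => ?_)
    obtain ⟨l, hl, hl2⟩ := hlift (f p) 0
    rw [show p = (h l).1 + (p - (h l).1) by abel]
    refine Submodule.add_mem_sup ⟨l, Prod.ext rfl hl2⟩ ?_
    rw [LinearMap.mem_ker, map_sub, hl, sub_self]
  have hsurj : Function.Surjective h := by
    rintro ⟨p, q⟩
    obtain ⟨l, -, hl⟩ := hlift 0 q
    have : p - (h l).1 ∈ (LinearMap.range h).comap (LinearMap.inl A P' Q) :=
      htop ▸ Submodule.mem_top
    obtain ⟨l', hl'⟩ := this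
    refine ⟨l' + l, ?_⟩
    rw [map_add, hl']
    exact Prod.ext (by simp) (by simp [hl])
  obtain ⟨s, hs⟩ := Module.projective_lifting_property h LinearMap.id hsurj
  have hs' : ∀ z, h (s z) = z := fun z => LinearMap.congr_fun hs z
  have hmem : ∀ y, y - s (h y) ∈ LinearMap.ker h := fun y => by
    rw [LinearMap.mem_ker, map_sub, hs', sub_self]
  let ρ : P →ₗ[A] LinearMap.ker h := (LinearMap.id - s ∘ₗ h).codRestrict _ hmem
  have hρ : ρ ∘ₗ (LinearMap.ker h).subtype = LinearMap.id := by
    refine LinearMap.ext fun b => Subtype.ext ?_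
    change b.1 - s (h b.1) = b.1
    rw [LinearMap.mem_ker.1 b.2, map_zero, sub_zero]
  let Φ : (LinearMap.ker f × LinearMap.ker h) →ₗ[A] P :=
    (s ∘ₗ LinearMap.inl A P' Q ∘ₗ (LinearMap.ker f).subtype).coprod (LinearMap.ker h).subtype
  have hΦ : ∀ a b, Φ (a, b) = s (a.1, 0) + b.1 := fun a b => rfl
  have hhΦ : ∀ a b, h (Φ (a, b)) = (a.1, 0) := fun a b => by
    rw [hΦ, map_add, hs', LinearMap.mem_ker.1 b.2, add_zero]
  have hΦinj : Function.Injective Φ := by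
    rw [injective_iff_map_eq_zero]
    rintro ⟨a, b⟩ hab
    have ha : a.1 = 0 := by
      have := hhΦ a b
      rw [hab, map_zero] at this
      exact (congrArg Prod.fst this).symm
    have hb : b.1 = 0 := by
      rw [hΦ, ha, Prod.mk_zero_zero, map_zero, zero_add] at hab
      exact hab
    exact Prod.ext (Subtype.ext ha) (Subtype.ext hb)
  -- Both sides are the preimage under h of ker f × 0; splitting h identifies this preimage with ker
  -- f × ker h.
  have hrange : LinearMap.range ι = LinearMap.range Φ := by
    rw [← hex.linearMap_ker_eq]
    ext y
    rw [LinearMap.mem_ker, ← e.map_eq_zero_iff, ← hh', Prod.mk_eq_zero]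
    constructor
    · rintro ⟨h1, h2⟩
      refine ⟨(⟨(h y).1, h1⟩, ⟨_, hmem y⟩), ?_⟩
      rw [hΦ]
      change s ((h y).1, 0) + (y - s (h y)) = y
      rw [← h2, Prod.mk.eta, add_sub_cancel]
    · rintro ⟨⟨a, b⟩, rfl⟩
      rw [hhΦ]
      exact ⟨a.2, rfl⟩
  refine ⟨ModuleCat.of A (LinearMap.ker h), inferInstanceAs (Module.Finite A (LinearMap.ker h)),
    Module.Projective.of_split _ _ hρ, ⟨?_⟩⟩
  exact LinearEquiv.ofInjective ι hι ≪≫ₗ LinearEquiv.ofEq _ _ hrange ≪≫ₗ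
    (LinearEquiv.ofInjective Φ hΦinj).symm

/-! ### Classes with cosyzygies and the comparison of the two dimensions. -/

/-- Every module of the class embeds into a finitely generated projective module with cokernel
in the class. -/
def HasCosyzygies (𝒳 : ObjectProperty (ModuleCat.{u} A)) : Prop :=
  ∀ X, 𝒳 X → ∃ (P Y : ModuleCat.{u} A) (ι : X →ₗ[A] P) (π : P →ₗ[A] Y),
    Module.Finite A P ∧ Module.Projective A P ∧ 𝒳 Y ∧
      Function.Injective ι ∧ Function.Surjective π ∧ Function.Exact ι π

/-- Z is an n-fold cosyzygy of X. The conclusion covers every choice of K because the Igusa–Todorov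
condition supplies its own syzygy. -/
lemma HasCosyzygies.exists_equiv_syzygy_prod [IsNoetherianRing A]
    {𝒳 : ObjectProperty (ModuleCat.{u} A)} (h𝒳 : HasCosyzygies 𝒳) (n : ℕ) :
    ∀ X, 𝒳 X → ∃ Z, 𝒳 Z ∧ ∀ K, IsSyzygy n Z K → ∃ Q : ModuleCat.{u} A,
      Module.Finite A Q ∧ Module.Projective A Q ∧ Nonempty (X ≃ₗ[A] K × Q) := by
  induction n with
  | zero =>
    rintro X hX
    refine ⟨X, hX, fun K ⟨e⟩ => ⟨ModuleCat.of A PUnit,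
      inferInstanceAs (Module.Finite A PUnit.{u + 1}),
      inferInstanceAs (Module.Projective A PUnit.{u + 1}), ⟨e.symm ≪≫ₗ LinearEquiv.prodUnique.symm⟩⟩⟩
  | succ n ih =>
    intro X hX
    obtain ⟨P, Y, ι, π, hPf, hPp, hY, hι, hπ, hex⟩ := h𝒳 X hX
    obtain ⟨Z, hZ, hZK⟩ := ih Y hY
    refine ⟨Z, hZ, ?_⟩
    rintro K ⟨Y', hY', P', f, hf, ⟨eK⟩⟩
    obtain ⟨Q, hQf, hQp, ⟨e⟩⟩ := hZK Y' hY'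
    obtain ⟨Q', hQf', hQp', ⟨e'⟩⟩ := exists_equiv_ker_prod hι hπ hex e hf
    exact ⟨Q', hQf', hQp', ⟨e' ≪≫ₗ eK.symm.prodCongr (LinearEquiv.refl A Q')⟩⟩

lemma HasCosyzygies.exists_hasAddResolution [IsNoetherianRing A]
    {𝒳 : ObjectProperty (ModuleCat.{u} A)} (h𝒳 : HasCosyzygies 𝒳)
    (hfg : 𝒳 ≤ ModuleCat.isFG.{u} A) {m n : ℕ} (h : IsIgusaTodorovAlgebra A m n) :
    ∃ M : ModuleCat.{u} A, Module.Finite A M ∧ ∀ X, 𝒳 X → HasAddResolution m M X := by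
  obtain ⟨U, hU, hres⟩ := h
  refine ⟨ModuleCat.of A (U × A), inferInstanceAs (Module.Finite A (U × A)), fun X hX => ?_⟩
  obtain ⟨Z, hZ, hZK⟩ := h𝒳.exists_equiv_syzygy_prod n X hX
  obtain ⟨K, hK, hKres⟩ := hres Z (hfg Z hZ)
  obtain ⟨Q, hQf, hQp, ⟨e⟩⟩ := hZK K hK
  exact hKres.of_equiv_prod e

/-- The cokernel of X → P⁰ is Ker(P¹ → P²), for which the complex shifted by one is a complete
resolution. -/
lemma hasCosyzygies_gproj [IsNoetherianRing A] : HasCosyzygies (gproj A) := by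
  rintro X ⟨-, P, d, hP, hd, hdual, ⟨e⟩⟩
  have hd0 : ∀ y, d 0 y ∈ LinearMap.ker (d (0 + 1)) := (hd 0).apply_apply_eq_zero
  have := (hP 0).1
  have := (hP (0 + 1)).1
  refine ⟨P 0, ModuleCat.of A (LinearMap.ker (d (0 + 1))), (LinearMap.ker (d 0)).subtype ∘ₗ e,
    (d 0).codRestrict _ hd0, (hP 0).1, (hP 0).2,
    ⟨inferInstanceAs (Module.Finite A (LinearMap.ker (d (0 + 1)))),
      fun i => P (i + 1), fun i => d (i + 1), fun i => hP _, fun i => hd _, fun i => hdual _,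
      ⟨LinearEquiv.refl _ _⟩⟩, (Submodule.subtype_injective _).comp e.injective, ?_, ?_⟩
  · rintro ⟨y, hy⟩
    obtain ⟨z, hz⟩ := (hd 0 y).1 hy
    exact ⟨z, Subtype.ext hz⟩
  · rw [LinearMap.exact_iff, show LinearMap.ker ((d 0).codRestrict _ hd0) = LinearMap.ker (d 0)
      from LinearMap.ker_codRestrict _ _ _, LinearEquiv.range_comp, Submodule.range_subtype]

/-- The weak resolution dimension as an infimum over natural numbers. -/
lemma weakResolDim_eq_iInf (𝒳 : ObjectProperty (ModuleCat.{u} A)) :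
    weakResolDim 𝒳 = ⨅ (m : ℕ) (_ : ∃ M : ModuleCat.{u} A, Module.Finite A M ∧
      ∀ X, 𝒳 X → HasAddResolution m M X), (m : ℕ∞) := by
  refine le_antisymm (le_iInf₂ fun m ⟨M, hM, h⟩ => ?_) (le_iInf₂ fun M hM => ?_)
  · exact (iInf₂_le M hM).trans (iSup₂_le fun X hX => iInf₂_le m (h X hX))
  · cases hm : weakResolDimWith M 𝒳 with
    | top => exact le_top
    | coe m =>
      refine iInf₂_le m ⟨M, hM, fun X hX => ?_⟩
      -- The strict bound by m + 1 extracts an actual resolution length at most m from the infimum.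
      have h1 : weakResolDimOfModule M X < ((m + 1 : ℕ) : ℕ∞) :=
        ((le_iSup₂ (f := fun X (_ : 𝒳 X) => weakResolDimOfModule M X) X hX).trans
          hm.le).trans_lt (by exact_mod_cast m.lt_succ_self)
      obtain ⟨n, hn⟩ := iInf_lt_iff.1 h1
      obtain ⟨hres, hn⟩ := iInf_lt_iff.1 hn
      exact hres.mono (by
        have : n < m + 1 := by exact_mod_cast hn
        lia)

lemma itDist_eq_weakResolDim [IsNoetherianRing A] {𝒳 : ObjectProperty (ModuleCat.{u} A)}
    (h𝒳 : HasCosyzygies 𝒳) (hfg : 𝒳 ≤ ModuleCat.isFG.{u} A) (n : ℕ)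
    (hsyz : ∀ X : ModuleCat.{u} A, Module.Finite A X → ∃ K, IsSyzygy n X K ∧ 𝒳 K) :
    itDist A = weakResolDim 𝒳 := by
  have : ∀ m, (∃ n, IsIgusaTodorovAlgebra A m n) ↔ ∃ M : ModuleCat.{u} A, Module.Finite A M ∧
      ∀ X, 𝒳 X → HasAddResolution m M X := by
    intro m
    constructor
    · rintro ⟨n, h⟩
      exact h𝒳.exists_hasAddResolution hfg h
    · rintro ⟨M, hM, h⟩
      refine ⟨n, M, hM, fun X hX => ?_⟩
      obtain ⟨K, hK, hK𝒳⟩ := hsyz X hX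
      exact ⟨K, hK, h K hK𝒳⟩
  rw [weakResolDim_eq_iInf, itDist]
  simp_rw [this]

end

end IgusaTodorov

/-! ### Left selfinjective Artinian rings: every module is torsionless. -/

namespace IgusaTodorov

section

variable {A : Type u} [Ring A]

lemma nonempty_equiv_of_ker_le {M S T : Type*} [AddCommGroup M] [Module A M] [AddCommGroup S]
    [Module A S] [AddCommGroup T] [Module A T] [IsSimpleModule A S] [IsSimpleModule A T]
    {f : M →ₗ[A] S} {g : M →ₗ[A] T} (hf : Function.Surjective f) (hg : g ≠ 0)
    (h : LinearMap.ker f ≤ LinearMap.ker g) : Nonempty (S ≃ₗ[A] T) := by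
  let φ : S →ₗ[A] T :=
    (LinearMap.ker f).liftQ g h ∘ₗ (f.quotKerEquivOfSurjective hf).symm.toLinearMap
  have hφ : ∀ x, φ (f x) = g x := fun x => by
    have : f x = f.quotKerEquivOfSurjective hf (Submodule.Quotient.mk x) := by simp
    rw [this]
    simp [φ]
  have hφ0 : φ ≠ 0 := by
    rintro h0
    refine hg (LinearMap.ext fun x => ?_)
    rw [← hφ, h0]
    rfl
  exact ⟨LinearEquiv.ofBijective φ (LinearMap.bijective_of_ne_zero hφ0)⟩

/-- In a sequence of simple modules over an Artinian ring, two members are isomorphic. -/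
lemma exists_equiv_of_simple_sequence [IsArtinianRing A] (S : ℕ → ModuleCat.{u} A)
    [∀ i, IsSimpleModule A (S i)] : ∃ a b, a < b ∧ Nonempty (S a ≃ₗ[A] S b) := by
  have hs : ∀ i, ∃ f : A →ₗ[A] S i, Function.Surjective f := fun i => by
    have := IsSimpleModule.nontrivial A (S i)
    obtain ⟨x, hx⟩ := exists_ne (0 : S i)
    exact ⟨LinearMap.toSpanSingleton A (S i) x, IsSimpleModule.toSpanSingleton_surjective A hx⟩
  choose f hf using hs
  have hf0 : ∀ i, f i ≠ 0 := fun i h => by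
    have := IsSimpleModule.nontrivial A (S i)
    obtain ⟨x, hx⟩ := exists_ne (0 : S i)
    obtain ⟨y, rfl⟩ := hf i x
    exact hx (by rw [h]; rfl)
  -- `J i` is the intersection of the kernels of the first i maps. The chain stabilises at some n,
  -- so `J n ≤ ker (f n)`; at the first index k + 1 with `J (k + 1) ≤ ker (f n)`, restricting `f k`
  -- and `f n` to `J k` gives S k ≅ S n.
  obtain ⟨J, hJ0, hJs⟩ : ∃ J : ℕ → Submodule A A, J 0 = ⊤ ∧
      ∀ i, J (i + 1) = J i ⊓ LinearMap.ker (f i) :=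
    ⟨Nat.rec ⊤ fun i I => I ⊓ LinearMap.ker (f i), rfl, fun _ => rfl⟩
  have hJ : Antitone J := antitone_nat_of_succ_le fun i => (hJs i).trans_le inf_le_left
  obtain ⟨n, hn⟩ := IsArtinian.monotone_stabilizes (R := A) (M := A)
    ⟨fun i => OrderDual.toDual (J i), fun _ _ h => hJ h⟩
  have hJn : J n ≤ LinearMap.ker (f n) := by
    have : J n = J (n + 1) := hn (n + 1) n.le_succ
    rw [this, hJs]
    exact inf_le_right
  obtain ⟨k, ⟨hspec, hle⟩, hmin⟩ := exists_minimal_of_wellFoundedLT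
    (fun k => J k ≤ LinearMap.ker (f n) ∧ k ≤ n) ⟨n, hJn, le_rfl⟩
  cases k with
  | zero =>
    refine absurd (LinearMap.ker_eq_top.1 (eq_top_iff.2 ?_)) (hf0 n)
    rwa [hJ0] at hspec
  | succ k =>
    have hk : ¬ J k ≤ LinearMap.ker (f n) := fun h =>
      absurd (hmin ⟨h, by lia⟩ k.le_succ) (by lia)
    have hker : LinearMap.ker ((f k).domRestrict (J k)) ≤
        LinearMap.ker ((f n).domRestrict (J k)) := fun x hx =>
          hspec ((hJs k).ge ⟨x.2, hx⟩)
    have hg : (f n).domRestrict (J k) ≠ 0 := fun h => hk fun x hx => LinearMap.congr_fun h ⟨x, hx⟩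
    have hne : (f k).domRestrict (J k) ≠ 0 := fun h => by
      rw [h, LinearMap.ker_zero, top_le_iff, LinearMap.ker_eq_top] at hker
      exact hg hker
    exact ⟨k, n, hle, nonempty_equiv_of_ker_le (LinearMap.surjective_of_ne_zero hne) hg hker⟩

/-- Finitely generated projective modules over a selfinjective ring are injective. -/
lemma IsSelfinjective.exists_extension (hA : IsSelfinjective A) {X Y Q : Type u}
    [AddCommGroup X] [Module A X] [AddCommGroup Y] [Module A Y] [AddCommGroup Q] [Module A Q]
    [Module.Finite A Q] [Module.Projective A Q] (j : X →ₗ[A] Y) (hj : Function.Injective j)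
    (φ : X →ₗ[A] Q) : ∃ ψ : Y →ₗ[A] Q, ∀ x, ψ (j x) = φ x := by
  obtain ⟨n, p, i, -, -, h⟩ := Module.Finite.exists_comp_eq_id_of_projective A Q
  choose ψ hψ using fun k => hA.out j hj (LinearMap.proj k ∘ₗ i ∘ₗ φ)
  refine ⟨p ∘ₗ LinearMap.pi ψ, fun x => ?_⟩
  have : LinearMap.pi ψ (j x) = i (φ x) := by
    ext k
    exact hψ k x
  change p (LinearMap.pi ψ (j x)) = _
  rw [this]
  exact LinearMap.congr_fun h (φ x)

/-- Over a selfinjective ring, simple modules are isomorphic as soon as their projective covers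
have a common simple submodule. -/
lemma IsSelfinjective.nonempty_equiv_of_common_submodule [IsNoetherianRing A]
    (hA : IsSelfinjective A) {S T P Q : ModuleCat.{u} A}
    [IsSimpleModule A S] [IsSimpleModule A T] [Module.Finite A P] [Module.Finite A Q]
    {f : P →ₗ[A] S} {g : Q →ₗ[A] T} (hf : IsProjectiveCover f) (hg : IsProjectiveCover g)
    {W : Type u} [AddCommGroup W] [Module A W] [Nontrivial W] {j : W →ₗ[A] P} {l : W →ₗ[A] Q}
    (hj : Function.Injective j) (hl : Function.Injective l) : Nonempty (S ≃ₗ[A] T) := by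
  have := hf.1
  have := hg.1
  obtain ⟨α, hα⟩ := hA.exists_extension j hj l
  obtain ⟨β, hβ⟩ := hA.exists_extension l hl j
  set γ : P →ₗ[A] P := β ∘ₗ α with hγ
  have hγj : ∀ w, γ (j w) = j w := fun w => by
    rw [hγ, LinearMap.comp_apply, hα, hβ]
  -- Otherwise γ maps into the superfluous ker f, so id - γ is surjective and hence injective, yet
  -- it kills W.
  have hfγ : f ∘ₗ γ ≠ 0 := by
    intro h0
    have hsurj : Function.Surjective (LinearMap.id - γ : P →ₗ[A] P) := by
      rw [← LinearMap.range_eq_top]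
      refine hf.2.2 _ (eq_top_iff.2 fun x _ => ?_)
      rw [show x = (LinearMap.id - γ : P →ₗ[A] P) x + γ x by simp]
      exact Submodule.add_mem_sup ⟨x, rfl⟩ (LinearMap.congr_fun h0 x)
    have hinj := (IsNoetherian.bijective_of_surjective_endomorphism _ hsurj).1
    obtain ⟨w, hw⟩ := exists_ne (0 : W)
    refine hw (hj (hinj ?_))
    simp [hγj]
  have hfβ : f ∘ₗ β ≠ 0 := fun h => hfγ (by rw [hγ, ← LinearMap.comp_assoc, h, LinearMap.zero_comp])
  have hfβs := LinearMap.surjective_of_ne_zero hfβ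
  have hg0 : g ≠ 0 := by
    rintro rfl
    have := IsSimpleModule.nontrivial A T
    obtain ⟨x, hx⟩ := exists_ne (0 : T)
    obtain ⟨y, hy⟩ := hg.2.1 x
    exact hx hy.symm
  refine nonempty_equiv_of_ker_le hfβs hg0 ?_
  -- ker g is maximal and superfluous, so a submodule not contained in it is all of Q; this would
  -- force f ∘ β = 0.
  by_contra hle
  refine hfβ (LinearMap.ker_eq_top.1 (hg.2.2 _ ?_))
  have hco : IsCoatom (LinearMap.ker g) :=
    isSimpleModule_iff_isCoatom.1 (IsSimpleModule.congr (g.quotKerEquivOfSurjective hg.2.1))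
  refine hco.2 _ (lt_of_le_of_ne le_sup_right fun h => hle ?_)
  rw [h]
  exact le_sup_left

lemma exists_simple_submodule [IsArtinianRing A] (P : ModuleCat.{u} A) [Module.Finite A P]
    [Nontrivial P] : ∃ (W : ModuleCat.{u} A) (j : W →ₗ[A] P),
      IsSimpleModule A W ∧ Function.Injective j := by
  have : IsAtomic (Submodule A P) :=
    isAtomic_of_orderBot_wellFounded_lt (IsWellFounded.wf)
  obtain ⟨W, hW, -⟩ := (eq_bot_or_exists_atom_le (⊤ : Submodule A P)).resolve_left top_ne_bot
  exact ⟨ModuleCat.of A W, W.subtype, isSimpleModule_iff_isAtom.2 hW,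
    Submodule.subtype_injective _⟩

/-- Over a left selfinjective Artinian ring, every simple left module embeds into the ring. -/
lemma IsSelfinjective.exists_ne_zero_of_isSimpleModule [IsArtinianRing A]
    (hA : IsSelfinjective A) (S : ModuleCat.{u} A) [hS : IsSimpleModule A S] :
    ∃ φ : S →ₗ[A] A, φ ≠ 0 := by
  have key : ∀ T : {T : ModuleCat.{u} A // IsSimpleModule A T},
      ∃ W : {T : ModuleCat.{u} A // IsSimpleModule A T}, ∃ (P : ModuleCat.{u} A)
        (f : P →ₗ[A] T.1) (j : W.1 →ₗ[A] P),
        Module.Finite A P ∧ IsProjectiveCover f ∧ Function.Injective j := by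
    rintro ⟨T, hT⟩
    obtain ⟨P, f, hP, hf⟩ := exists_isProjectiveCover T
    have := IsSimpleModule.nontrivial A T
    have := hf.2.1.nontrivial
    obtain ⟨W, j, hW, hj⟩ := exists_simple_submodule P
    exact ⟨⟨W, hW⟩, P, f, j, hP, hf, hj⟩
  choose s P f j hP hf hj using key
  -- Each term is a simple submodule of the projective cover of the preceding one. A repetition in
  -- the sequence cancels back to index 0, so S itself embeds in a projective cover.
  let Z : ℕ → {T : ModuleCat.{u} A // IsSimpleModule A T} := fun n => s^[n] ⟨S, hS⟩
  have hZ : ∀ n, Z (n + 1) = s (Z n) := fun n => Function.iterate_succ_apply' _ _ _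
  have hsimple : ∀ n, IsSimpleModule A (Z n).1 := fun n => (Z n).2
  obtain ⟨a, b, hab, hiso⟩ := exists_equiv_of_simple_sequence fun n => (Z n).1
  obtain ⟨c, rfl⟩ := Nat.exists_eq_add_of_lt hab
  have hcancel : Nonempty ((Z 0).1 ≃ₗ[A] (Z (c + 1)).1) := by
    clear hab
    induction a with
    | zero => rwa [zero_add] at hiso
    | succ a ih =>
      refine ih ?_
      rw [show a + 1 + c + 1 = (a + c + 1) + 1 by lia, hZ, hZ] at hiso
      obtain ⟨e⟩ := hiso
      have := hP (Z a)
      have := hP (Z (a + c + 1))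
      have := (s (Z a)).2
      have := IsSimpleModule.nontrivial A (s (Z a)).1
      exact hA.nonempty_equiv_of_common_submodule (hf (Z a)) (hf (Z (a + c + 1)))
        (hj (Z a)) (l := j (Z (a + c + 1)) ∘ₗ e.toLinearMap) ((hj _).comp e.injective)
  rw [hZ] at hcancel
  obtain ⟨e⟩ := hcancel
  have := hP (Z c)
  have := (hf (Z c)).1
  obtain ⟨n, p, i, -, hi, -⟩ := Module.Finite.exists_comp_eq_id_of_projective A (P (Z c))
  let κ : S →ₗ[A] (Fin n → A) := i ∘ₗ j (Z c) ∘ₗ e.toLinearMap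
  have hκ : Function.Injective κ := hi.comp ((hj _).comp e.injective)
  by_contra! hzero
  have := IsSimpleModule.nontrivial A S
  obtain ⟨x, hx⟩ := exists_ne (0 : S)
  refine hx (hκ ?_)
  ext k
  rw [map_zero]
  exact LinearMap.congr_fun (hzero (LinearMap.proj k ∘ₗ κ)) x

/-- Over a left selfinjective Artinian ring, all modules are torsionless. -/
lemma IsSelfinjective.torsionless [IsArtinianRing A] (hA : IsSelfinjective A) {X : Type u}
    [AddCommGroup X] [Module A X] (x : X) (hx : ∀ φ : X →ₗ[A] A, φ x = 0) : x = 0 := by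
  by_contra hne
  let t : A →ₗ[A] X := LinearMap.toSpanSingleton A X x
  have ht : LinearMap.ker t ≠ ⊤ := fun h => hne (by
    have : (1 : A) ∈ LinearMap.ker t := h ▸ Submodule.mem_top
    simpa [t] using this)
  obtain ⟨m, hm, hle⟩ := Ideal.exists_le_maximal (LinearMap.ker t) ht
  have : IsSimpleModule A (A ⧸ m) := isSimpleModule_iff_isCoatom.2 hm.out
  obtain ⟨φ, hφ⟩ := hA.exists_ne_zero_of_isSimpleModule (ModuleCat.of A (A ⧸ m))
  -- The cyclic module Ax ≅ A / ker t has the simple quotient A / m, which maps nontrivially to A;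
  -- injectivity extends the composite to X, and this form does not kill x.
  obtain ⟨ψ, hψ⟩ := hA.exists_extension (Q := A) ((LinearMap.ker t).liftQ t le_rfl)
    (LinearMap.ker_eq_bot.1 (Submodule.ker_liftQ_eq_bot _ _ _ le_rfl))
    ((LinearMap.ker t).liftQ (φ ∘ₗ m.mkQ) (hle.trans fun a ha => by
      rw [LinearMap.mem_ker, LinearMap.comp_apply, Submodule.mkQ_apply,
        (Submodule.Quotient.mk_eq_zero m).2 ha]
      exact map_zero φ))
  have h1 : φ (Submodule.Quotient.mk 1) = 0 := by
    have h2 := hψ (Submodule.Quotient.mk 1)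
    rw [Submodule.liftQ_apply, Submodule.liftQ_apply] at h2
    refine h2.symm.trans ?_
    rw [show t 1 = x by simp [t]]
    exact hx ψ
  refine hφ (LinearMap.ext fun y => ?_)
  obtain ⟨a, rfl⟩ := Submodule.Quotient.mk_surjective m y
  have : (Submodule.Quotient.mk a : A ⧸ m) = a • Submodule.Quotient.mk 1 := by
    rw [← Submodule.Quotient.mk_smul, smul_eq_mul, mul_one]
  rw [this]
  exact (map_smul φ a _).trans (by rw [h1, smul_zero]; rfl)

lemma IsSelfinjective.hasCosyzygies [IsArtinianRing A] [IsNoetherian Aᵐᵒᵖ A]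
    (hA : IsSelfinjective A) : HasCosyzygies (ModuleCat.isFG.{u} A) := by
  intro X hX
  have : Module.Finite A X := hX
  obtain ⟨n, ι, hι, -⟩ := exists_approximation (A := A) (M := X) hA.torsionless
  exact ⟨ModuleCat.of A (Fin n → A), ModuleCat.of A ((Fin n → A) ⧸ LinearMap.range ι), ι,
    (LinearMap.range ι).mkQ, inferInstanceAs (Module.Finite A (Fin n → A)),
    inferInstanceAs (Module.Projective A (Fin n → A)),
    inferInstanceAs (Module.Finite A ((Fin n → A) ⧸ LinearMap.range ι)), hι,
    Submodule.mkQ_surjective _, LinearMap.exact_map_mkQ_range ι⟩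

end

end IgusaTodorov

theorem mainTheorem7 (k : Type v) [CommRing k] [IsArtinianRing k]
    (A : Type u) [Ring A] [Algebra k A] [Module.Finite k A] :
    (IgusaTodorov.IsGorenstein A →
      IgusaTodorov.itDist A = IgusaTodorov.weakResolDim (IgusaTodorov.gproj A)) ∧
    (IgusaTodorov.IsSelfinjective A →
      IgusaTodorov.itDist A = IgusaTodorov.weakResolDim (ModuleCat.isFG.{u} A)) := by
  have : IsArtinianRing A := isArtinian_of_tower k inferInstance
  have : IsNoetherian Aᵐᵒᵖ A := isNoetherian_of_tower k inferInstance
  constructor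
  · rintro ⟨⟨d, hd⟩, d', hd'⟩
    exact IgusaTodorov.itDist_eq_weakResolDim IgusaTodorov.hasCosyzygies_gproj (fun X hX => hX.1) d
      fun X hX => IgusaTodorov.exists_isSyzygy_gproj hd hd' X
  · intro hA
    exact IgusaTodorov.itDist_eq_weakResolDim hA.hasCosyzygies le_rfl 0
      fun X hX => ⟨X, ⟨LinearEquiv.refl A X⟩, hX⟩
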